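/- All spaces are Tychonoff. A (Tychonoff) space is pseudocompact if every continuous real-valued function on it is bounded, and $X$ is locally pseudocompact if every point of $X$ has an open neighborhood with pseudocompact closure. An extension of $X$ is a space containing $X$ as a dense subspace; two extensions are identified if some homeomorphism between them fixes $X$ pointwise. A compactification (pseudocompactification) of $X$ is a compact Hausdorff (pseudocompact) extension of $X$, and the remainder of an extension $Y$ of $X$ is $Y\setminus X$. Let $\beta X$ be the Stone–Čech compactification and $\upsilon X\subseteq\beta X$ the Hewitt realcompactification of $X$, i.e. the set of all $p\in\beta X$ at which, for every continuous $f:X\to\mathbb R$, the continuous extension $\beta X\to\mathbb R\cup\{\infty\}$ of $f$ is finite. Put $\zeta X=X\cup\mathrm{cl}_{\beta X}(\beta X\setminus\upsilon X)$. **Theorem.** Let $X$ be a locally pseudocompact space. (1) Let $K$ be a compactification of $X$, let $\phi:\beta X\to K$ be the continuous extension of $\mathrm{id}_X$, and let $E$ be a compact subset of $K\setminus X$ containing $\phi[\zeta X\setminus X]$. Then the subspace $X\cup E$ of $K$ is a pseudocompactification of $X$ with compact remainder. (2) Conversely, every pseudocompactification $Y$ of $X$ with compact remainder is of this form: there are a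 compactification $K$ of $X$, with $\phi:\beta X\to K$ the continuous extension of $\mathrm{id}_X$, and a compact set $E\subseteq K\setminus X$ containing $\phi[\zeta X\setminus X]$, such that $Y$ is homeomorphic to the subspace $X\cup E$ of $K$ by a homeomorphism fixing $X$ pointwise. -/

import Mathlib

open Set

universe u v w

/-- A space is pseudocompact if it is Tychonoff and every continuous real-valued function
on it is bounded. -/
def IsPseudocompactSpace (Y : Type v) [TopologicalSpace Y] : Prop :=
  T35Space Y ∧ ∀ f : C(Y, ℝ), ∃ M : ℝ, ∀ y, |f y| ≤ M

/-- A Tychonoff space is locally pseudocompact if every point has an open neighbourhood whose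
closure (as a subspace) is pseudocompact. -/
def IsLocallyPseudocompactSpace (X : Type u) [TopologicalSpace X] : Prop :=
  T35Space X ∧ ∀ x : X, ∃ U : Set X, IsOpen U ∧ x ∈ U ∧ IsPseudocompactSpace (closure U)

/-- `K` is a compactification of `X` via `j`: a compact Hausdorff space in which `j` embeds `X`
as a dense subspace. -/
structure IsCompactification {X : Type u} {K : Type v} [TopologicalSpace X] [TopologicalSpace K]
    (j : X → K) : Prop where
  isDenseEmbedding : IsDenseEmbedding j
  compactSpace : CompactSpace K
  t2Space : T2Space K

/-- `Y` is a pseudocompactification of `X` via `i`: a pseudocompact space in which `i` embeds `X`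
as a dense subspace. -/
structure IsPseudocompactification {X : Type u} {Y : Type v} [TopologicalSpace X]
    [TopologicalSpace Y] (i : X → Y) : Prop where
  isDenseEmbedding : IsDenseEmbedding i
  isPseudocompactSpace : IsPseudocompactSpace Y

/-- The remainder `Y \ X` of the extension `i : X → Y` is compact. -/
def HasCompactRemainder {X : Type u} {Y : Type v} [TopologicalSpace Y] (i : X → Y) : Prop :=
  IsCompact (range i)ᶜ

/-- The extension of `f : X → ℝ` to a continuous map from `βX` to the one-point compactification
of `ℝ`. -/
noncomputable def stoneCechExtendOnePoint {X : Type u} [TopologicalSpace X] (f : C(X, ℝ)) :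
    StoneCech X → OnePoint ℝ :=
  stoneCechExtend (OnePoint.continuous_coe.comp f.continuous)

/-- The Hewitt realcompactification `υX` as a subset of `βX`: the points at which the extension
`βX → ℝ ∪ {∞}` of every continuous `f : X → ℝ` is finite. -/
def hewittRealcompactification (X : Type u) [TopologicalSpace X] : Set (StoneCech X) :=
  {p | ∀ f : C(X, ℝ), stoneCechExtendOnePoint f p ≠ OnePoint.infty}

/-- `ζX = X ∪ cl_{βX} (βX \ υX)`, as a subset of `βX`. -/
def zetaExtension (X : Type u) [TopologicalSpace X] : Set (StoneCech X) :=
  range (stoneCechUnit : X → StoneCech X) ∪ closure (hewittRealcompactification X)ᶜ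

/-- The map from `X` into the subspace `X ∪ E` of `K`, where `X` is placed in `K` by `j`. -/
def toUnion {X : Type u} {K : Type v} (j : X → K) (E : Set K) (x : X) :
    (range j ∪ E : Set K) :=
  ⟨j x, Or.inl (mem_range_self x)⟩

/-- The data in the construction of `X ∪ E`: `K` is a compactification of `X` via `j`,
`φ : βX → K` is the continuous extension of the inclusion of `X`, and `E` is a compact subset of
`K \ X` that contains `φ[ζX \ X]`. -/
structure IsAdmissible {X : Type u} {K : Type v} [TopologicalSpace X] [TopologicalSpace K]
    (j : X → K) (φ : StoneCech X → K) (E : Set K) : Prop where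
  isCompactification : IsCompactification j
  continuous_extension : Continuous φ
  extension_apply : ∀ x, φ (stoneCechUnit x) = j x
  isCompact : IsCompact E
  subset_remainder : E ⊆ (range j)ᶜ
  image_zeta_subset : φ '' (zetaExtension X \ range stoneCechUnit) ⊆ E

/-!
A continuous function on a dense subspace `X` of `Y` is bounded unless its extension to `βX` is
infinite at some `p ∉ υX`. If the trace on `X` of the neighbourhoods of each such `p` converges in
`Y`, then a function continuous on all of `Y` is finite along this trace, hence bounded.

Conversely, let `X` be open in the pseudocompact space `Y`, and suppose that `f : X → ℝ` is
infinite at `p`. If the image of `p` in a compactification of `Y` were not in the closure of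
`Y \ X`, a bump function around it vanishing near `Y \ X` would turn `f` into an unbounded
continuous function on `Y`. So `βX \ υX`, and with it its closure, is sent to `Y \ X` when the
latter is compact.
-/

open Filter Topology

section DenseEmbeddings

variable {X : Type u} {Y : Type v} {Z : Type w} [TopologicalSpace X] [TopologicalSpace Y]
  [TopologicalSpace Z]

theorem isDenseEmbedding_comp {e : Y → Z} {i : X → Y} (he : IsDenseEmbedding e)
    (hi : IsDenseEmbedding i) : IsDenseEmbedding (e ∘ i) :=
  have hei := he.isEmbedding.comp hi.isEmbedding
  ⟨⟨hei.isInducing, he.dense.comp hi.dense he.continuous⟩, hei.injective⟩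

theorem isDenseEmbedding_toUnion {j : X → Y} (hj : IsDenseEmbedding j) (E : Set Y) :
    IsDenseEmbedding (toUnion j E) := by
  have hE : IsEmbedding (toUnion j E) :=
    hj.isEmbedding.codRestrict (range j ∪ E) fun x => Or.inl (mem_range_self x)
  refine ⟨⟨hE.isInducing, fun y => ?_⟩, hE.injective⟩
  rw [closure_subtype, ← range_comp]
  exact hj.dense y

end DenseEmbeddings

theorem compl_range_toUnion {X : Type u} {Y : Type v} {j : X → Y} {E : Set Y}
    (hE : E ⊆ (range j)ᶜ) :
    (range (toUnion j E))ᶜ = Subtype.val ⁻¹' E := by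
  ext ⟨y, hy⟩
  have hrange : (⟨y, hy⟩ : (range j ∪ E : Set Y)) ∈ range (toUnion j E) ↔ y ∈ range j :=
    exists_congr fun _ => Subtype.ext_iff
  rw [mem_compl_iff, hrange]
  exact ⟨hy.resolve_left, fun hyE => hE hyE⟩

theorem exists_homeomorph_toUnion_image_compl_range {X : Type u} {Y : Type v} {Z : Type w}
    [TopologicalSpace Y] [TopologicalSpace Z] {e : Y → Z} (he : IsEmbedding e) (i : X → Y) :
    ∃ h : Y ≃ₜ (range (e ∘ i) ∪ e '' (range i)ᶜ : Set Z),
      ∀ x, h (i x) = toUnion (e ∘ i) (e '' (range i)ᶜ) x := by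
  have hrange : range e = range (e ∘ i) ∪ e '' (range i)ᶜ := by
    rw [range_comp, ← image_union, union_compl_self, image_univ]
  exact ⟨he.toHomeomorph.trans (Homeomorph.setCongr hrange), fun _ => rfl⟩

section BumpFunctions

theorem exists_continuous_eq_one_disjoint_tsupport {Z : Type w} [TopologicalSpace Z]
    [CompletelyRegularSpace Z] {A : Set Z} (hA : IsClosed A) {z : Z} (hz : z ∉ A) :
    ∃ b : C(Z, ℝ), b z = 1 ∧ Disjoint (tsupport b) A := by
  obtain ⟨C, hC, hC_closed, hCA⟩ := exists_mem_nhds_isClosed_subset (hA.isOpen_compl.mem_nhds hz)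
  obtain ⟨g, hg, hgz, hgC⟩ := CompletelyRegularSpace.completely_regular_isOpen z (interior C)
    isOpen_interior (mem_interior_iff_mem_nhds.2 hC)
  refine ⟨⟨fun y => 1 - g y, by fun_prop⟩, by simp [hgz], ?_⟩
  have hsupport : Function.support (fun y => (1 - g y : ℝ)) ⊆ C := by
    refine Function.support_subset_iff'.2 fun y hy => ?_
    simp [hgC fun hyC => hy (interior_subset hyC)]
  exact subset_compl_iff_disjoint_right.1 ((closure_minimal hsupport hC_closed).trans hCA)

theorem continuous_mul_extend_of_tsupport_subset {X Y R : Type*} [TopologicalSpace X]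
    [TopologicalSpace Y] [TopologicalSpace R] [MulZeroClass R] [ContinuousMul R] {i : X → Y}
    (hi : IsOpenEmbedding i) {f : X → R} (hf : Continuous f) {b : Y → R} (hb : Continuous b)
    (hsupp : tsupport b ⊆ range i) (g : Y → R) :
    Continuous fun y => b y * Function.extend i f g y := by
  refine continuous_of_tsupport fun y hy => ?_
  obtain ⟨x, rfl⟩ := hsupp (tsupport_mul_subset_left hy)
  refine hb.continuousAt.mul (hi.continuousAt_iff.1 ?_)
  rw [Function.extend_comp hi.injective]
  exact hf.continuousAt

end BumpFunctions

section StoneCech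

variable {X : Type u} [TopologicalSpace X]

instance comap_stoneCechUnit_nhds_neBot (p : StoneCech X) :
    NeBot (comap (stoneCechUnit : X → StoneCech X) (𝓝 p)) :=
  comap_neBot_iff_frequently.2 (mem_closure_iff_frequently.1 (denseRange_stoneCechUnit p))

theorem tendsto_comap_stoneCechUnit {Z : Type w} [TopologicalSpace Z] {φ : StoneCech X → Z}
    (hφ : Continuous φ) {j : X → Z} (hφj : ∀ x, φ (stoneCechUnit x) = j x) (p : StoneCech X) :
    Tendsto j (comap stoneCechUnit (𝓝 p)) (𝓝 (φ p)) :=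
  ((hφ.tendsto p).comp tendsto_comap).congr hφj

theorem continuous_stoneCechExtendOnePoint (f : C(X, ℝ)) :
    Continuous (stoneCechExtendOnePoint f) :=
  continuous_stoneCechExtend _

theorem stoneCechExtendOnePoint_unit (f : C(X, ℝ)) (x : X) :
    stoneCechExtendOnePoint f (stoneCechUnit x) = (f x : OnePoint ℝ) :=
  stoneCechExtend_stoneCechUnit _ x

theorem stoneCechExtendOnePoint_eq_coe_of_tendsto {f : C(X, ℝ)} {p : StoneCech X} {a : ℝ}
    (h : Tendsto f (comap stoneCechUnit (𝓝 p)) (𝓝 a)) : stoneCechExtendOnePoint f p = a :=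
  tendsto_nhds_unique (tendsto_comap_stoneCechUnit (continuous_stoneCechExtendOnePoint f)
    (stoneCechExtendOnePoint_unit f) p) ((OnePoint.continuous_coe.tendsto a).comp h)

theorem tendsto_abs_atTop_of_stoneCechExtendOnePoint_eq_infty {f : C(X, ℝ)} {p : StoneCech X}
    (h : stoneCechExtendOnePoint f p = OnePoint.infty) :
    Tendsto (fun x => |f x|) (comap stoneCechUnit (𝓝 p)) atTop := by
  have hf := tendsto_comap_stoneCechUnit (continuous_stoneCechExtendOnePoint f)
    (stoneCechExtendOnePoint_unit f) p
  rw [h] at hf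
  have hcocompact : Tendsto f (comap stoneCechUnit (𝓝 p)) (cocompact ℝ) := by
    rw [← coclosedCompact_eq_cocompact, ← OnePoint.comap_coe_nhds_infty]
    exact tendsto_comap_iff.2 hf
  exact tendsto_norm_cocompact_atTop.comp hcocompact

theorem exists_abs_le_of_stoneCechExtendOnePoint_ne_infty {f : C(X, ℝ)}
    (h : ∀ p, stoneCechExtendOnePoint f p ≠ OnePoint.infty) : ∃ M : ℝ, ∀ x, |f x| ≤ M := by
  have hrange : IsCompact (range (stoneCechExtendOnePoint f)) :=
    isCompact_range (continuous_stoneCechExtendOnePoint f)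
  have hreal : IsCompact ((↑) ⁻¹' range (stoneCechExtendOnePoint f) : Set ℝ) := by
    refine OnePoint.isOpenEmbedding_coe.isInducing.isCompact_preimage' hrange ?_
    rintro _ ⟨p, rfl⟩
    exact OnePoint.ne_infty_iff_exists.1 (h p)
  obtain ⟨M, hM⟩ := hreal.isBounded.exists_norm_le
  exact ⟨M, fun x => hM _ ⟨stoneCechUnit x, stoneCechExtendOnePoint_unit f x⟩⟩

theorem notMem_hewittRealcompactification_iff {p : StoneCech X} :
    p ∉ hewittRealcompactification X ↔
      ∃ f : C(X, ℝ), stoneCechExtendOnePoint f p = OnePoint.infty := by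
  simp only [hewittRealcompactification, mem_ofPred_eq, not_forall, not_not]

theorem compl_hewittRealcompactification_subset_zetaExtension_diff :
    (hewittRealcompactification X)ᶜ ⊆ zetaExtension X \ range stoneCechUnit := by
  refine fun p hp => ⟨Or.inr (subset_closure hp), ?_⟩
  rintro ⟨x, rfl⟩
  obtain ⟨f, hf⟩ := notMem_hewittRealcompactification_iff.1 hp
  rw [stoneCechExtendOnePoint_unit] at hf
  exact OnePoint.coe_ne_infty _ hf

variable {Y : Type v} [TopologicalSpace Y] {i : X → Y}

theorem exists_abs_le_of_tendsto_comap_stoneCechUnit (hi : Continuous i) (hd : DenseRange i)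
    (hlim : ∀ p ∉ hewittRealcompactification X,
      ∃ y, Tendsto i (comap stoneCechUnit (𝓝 p)) (𝓝 y)) (g : C(Y, ℝ)) :
    ∃ M : ℝ, ∀ y, |g y| ≤ M := by
  obtain ⟨M, hM⟩ : ∃ M : ℝ, ∀ x, |g (i x)| ≤ M := by
    refine exists_abs_le_of_stoneCechExtendOnePoint_ne_infty (f := g.comp ⟨i, hi⟩) fun p hp => ?_
    obtain ⟨y, hy⟩ := hlim p (notMem_hewittRealcompactification_iff.2 ⟨_, hp⟩)
    have hfinite := stoneCechExtendOnePoint_eq_coe_of_tendsto (f := g.comp ⟨i, hi⟩)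
      ((g.continuous.tendsto y).comp hy)
    exact OnePoint.coe_ne_infty _ (hfinite.symm.trans hp)
  exact ⟨M, fun y => hd.induction_on y (isClosed_le g.continuous.abs continuous_const) hM⟩

theorem map_mem_closure_image_compl_range {Z : Type w} [TopologicalSpace Z]
    [CompletelyRegularSpace Z] (hi : IsOpenEmbedding i)
    (hY : ∀ g : C(Y, ℝ), ∃ M : ℝ, ∀ y, |g y| ≤ M) {e : Y → Z} (he : Continuous e)
    {φ : StoneCech X → Z} (hφ : Continuous φ) (hφi : ∀ x, φ (stoneCechUnit x) = e (i x))
    {p : StoneCech X} (hp : p ∉ hewittRealcompactification X) :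
    φ p ∈ closure (e '' (range i)ᶜ) := by
  by_contra hpE
  obtain ⟨f, hf⟩ := notMem_hewittRealcompactification_iff.1 hp
  obtain ⟨b, hbp, hbE⟩ := exists_continuous_eq_one_disjoint_tsupport isClosed_closure hpE
  have hsupp : tsupport (b ∘ e) ⊆ range i := fun y hy => by
    by_contra hyi
    exact hbE.notMem_of_mem_left (tsupport_comp_subset_preimage b he hy)
      (subset_closure (mem_image_of_mem e hyi))
  obtain ⟨M, hM⟩ := hY ⟨_, continuous_mul_extend_of_tsupport_subset hi f.continuous
    (b.continuous.comp he) hsupp 0⟩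
  have hb : Tendsto (fun x => |b (e (i x))|) (comap stoneCechUnit (𝓝 p)) (𝓝 1) := by
    rw [← abs_one, ← hbp]
    exact ((b.continuous.tendsto _).comp (tendsto_comap_stoneCechUnit hφ hφi p)).abs
  have hbf := hb.pos_mul_atTop one_pos (tendsto_abs_atTop_of_stoneCechExtendOnePoint_eq_infty hf)
  obtain ⟨x, hx⟩ := (hbf.eventually_gt_atTop M).exists
  have hMx := hM (i x)
  rw [ContinuousMap.coe_mk, hi.injective.extend_apply, abs_mul] at hMx
  exact hx.not_ge hMx

end StoneCech

namespace IsAdmissible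

variable {X : Type u} {K : Type v} [TopologicalSpace X] [TopologicalSpace K] {j : X → K}
  {φ : StoneCech X → K} {E : Set K}

theorem exists_tendsto_toUnion (h : IsAdmissible j φ E) {p : StoneCech X}
    (hp : p ∉ hewittRealcompactification X) :
    ∃ y, Tendsto (toUnion j E) (comap stoneCechUnit (𝓝 p)) (𝓝 y) := by
  have hpE : φ p ∈ E := h.image_zeta_subset
    (mem_image_of_mem φ (compl_hewittRealcompactification_subset_zetaExtension_diff hp))
  exact ⟨⟨φ p, Or.inr hpE⟩, tendsto_subtype_rng.2
    (tendsto_comap_stoneCechUnit h.continuous_extension h.extension_apply p)⟩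

theorem isPseudocompactification (h : IsAdmissible j φ E) :
    IsPseudocompactification (toUnion j E) := by
  have := h.isCompactification.compactSpace
  have := h.isCompactification.t2Space
  have hd := isDenseEmbedding_toUnion h.isCompactification.isDenseEmbedding E
  exact ⟨hd, inferInstance, exists_abs_le_of_tendsto_comap_stoneCechUnit hd.continuous hd.dense
    fun _ hp => h.exists_tendsto_toUnion hp⟩

theorem hasCompactRemainder (h : IsAdmissible j φ E) : HasCompactRemainder (toUnion j E) := by
  rw [HasCompactRemainder, compl_range_toUnion h.subset_remainder]
  refine IsInducing.subtypeVal.isCompact_preimage' h.isCompact ?_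
  rw [Subtype.range_coe]
  exact subset_union_right

end IsAdmissible

theorem isCompactification_stoneCechUnit (Y : Type v) [TopologicalSpace Y] [T35Space Y] :
    IsCompactification (stoneCechUnit : Y → StoneCech Y) :=
  ⟨isDenseEmbedding_stoneCechUnit, inferInstance, inferInstance⟩

theorem IsPseudocompactification.isAdmissible {X : Type u} {Y : Type v} {K : Type w}
    [TopologicalSpace X] [TopologicalSpace Y] [TopologicalSpace K] {i : X → Y}
    (hi : IsPseudocompactification i) (hr : HasCompactRemainder i) {e : Y → K}
    (he : IsCompactification e) {φ : StoneCech X → K} (hφ : Continuous φ)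
    (hφi : ∀ x, φ (stoneCechUnit x) = e (i x)) :
    IsAdmissible (e ∘ i) φ (e '' (range i)ᶜ) := by
  have := hi.isPseudocompactSpace.1
  have := he.compactSpace
  have := he.t2Space
  have hopen : IsOpenEmbedding i :=
    ⟨hi.isDenseEmbedding.isEmbedding, isClosed_compl_iff.1 (IsCompact.isClosed hr)⟩
  have hE : IsCompact (e '' (range i)ᶜ) := IsCompact.image hr he.isDenseEmbedding.continuous
  refine ⟨⟨isDenseEmbedding_comp he.isDenseEmbedding hi.isDenseEmbedding, ‹_›, ‹_›⟩, hφ, hφi, hE,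
    ?_, ?_⟩
  · rw [range_comp, subset_compl_iff_disjoint_left,
      disjoint_image_iff he.isDenseEmbedding.injective]
    exact disjoint_compl_right
  · have hυ : (hewittRealcompactification X)ᶜ ⊆ φ ⁻¹' (e '' (range i)ᶜ) := fun p hp =>
      hE.isClosed.closure_subset <| map_mem_closure_image_compl_range hopen
        hi.isPseudocompactSpace.2 he.isDenseEmbedding.continuous hφ hφi hp
    rintro _ ⟨p, ⟨hp, hpX⟩, rfl⟩
    exact closure_minimal hυ (hE.isClosed.preimage hφ) (hp.resolve_left hpX)

theorem theorem4p4 {X : Type u} [TopologicalSpace X] (hX : IsLocallyPseudocompactSpace X) :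
    (∀ (K : Type v) [TopologicalSpace K] (j : X → K) (φ : StoneCech X → K) (E : Set K),
      IsAdmissible j φ E →
        IsPseudocompactification (toUnion j E) ∧ HasCompactRemainder (toUnion j E)) ∧
    (∀ (Y : Type w) [TopologicalSpace Y] (i : X → Y),
      IsPseudocompactification i → HasCompactRemainder i →
        ∃ (K : Type w) (_ : TopologicalSpace K) (j : X → K) (φ : StoneCech X → K) (E : Set K),
          IsAdmissible j φ E ∧
            ∃ h : Y ≃ₜ (range j ∪ E : Set K), ∀ x, h (i x) = toUnion j E x) := by
  refine ⟨fun K _ j φ E h => ⟨h.isPseudocompactification, h.hasCompactRemainder⟩,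
    fun Y _ i hi hr => ?_⟩
  have := hi.isPseudocompactSpace.1
  have hβ := isCompactification_stoneCechUnit Y
  have hcont : Continuous ((stoneCechUnit : Y → StoneCech Y) ∘ i) :=
    hβ.isDenseEmbedding.continuous.comp hi.isDenseEmbedding.continuous
  exact ⟨StoneCech Y, inferInstance, stoneCechUnit ∘ i, stoneCechExtend hcont,
    stoneCechUnit '' (range i)ᶜ,
    hi.isAdmissible hr hβ (continuous_stoneCechExtend hcont) (stoneCechExtend_stoneCechUnit hcont),
    exists_homeomorph_toUnion_image_compl_range hβ.isDenseEmbedding.isEmbedding i⟩
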